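/- Let $B=(V,E)$ be a Bratteli diagram: $V=\coprod_{n\ge 0}V_n$ and $E=\coprod_{n\ge 1}E_n$ with all $V_n,E_n$ finite and non-empty, and with maps $i\colon E_n\to V_{n-1}$ (surjective) and $t\colon E_n\to V_n$. Let $S(B)=V\setminus t(E)$ be its set of sources, and let $X_B$ be the space of infinite paths in $B$ starting at a source, with the topology generated by the cylinder sets of finite paths. For $N\ge 0$ let $P_N\subseteq X_B\times X_B$ be the set of pairs $(x,y)$ of paths that start at level at most $N$ and satisfy $x_k=y_k$ for all $k>N$. Let $\mathcal G_B=\bigcup_N P_N$, with the inductive limit topology of the $P_N\subseteq X_B\times X_B$ and the operations $(x,y)(y,z)=(x,z)$, $(x,y)^{-1}=(y,x)$. Let $\mathcal G$ be a topological groupoid with compact unit space that is isomorphic to $\mathcal G_B$; every AF groupoid with compact unit space is of this form. Identify $\mathcal G$ with $\mathcal G_B$, and put $$\ell(x,y)=\begin{cases}0 & \text{if } x=y,\\ \sum_{v\in S(B)}|P(v,V_{k(x,y)})| & \text{if } x\ne y,\end{cases}$$ where $k(x,y)=\min\{m : (x,y)\in P_m\}$ and $P(v,V_k)$ is the set of finite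 paths from $v$ to a vertex in $V_k$ (the path of length zero included if $v\in V_k$). Then for every unit $y\in\mathcal G^{(0)}$ and every real $M\ge 0$, with $\mathcal G_y=\{\gamma\in\mathcal G : s(\gamma)=y\}$, $$|\{\gamma\in\mathcal G_y : \ell(\gamma)\le M\}|\le\max\{1,M\}.$$ In particular $(\mathcal G,\ell)$ has linear growth: there is a real polynomial $p$ of degree at most $1$ such that $|\{\gamma\in\mathcal G_u : \ell(\gamma)\le t\}|\le p(t)$ for all $t\ge 0$ and all $u\in\mathcal G^{(0)}$. Consequently $(\mathcal G,\ell)$ has rapid decay: there are constants $C,s\ge 0$ such that for all $f\in C_c(\mathcal G)$ $$\|\Lambda(f)\|\le C\,\|f\|_{2,s},\qquad \|f\|_{2,s}=\max\Big\{\sup_{u}\Big(\sum_{s(\gamma)=u}|f(\gamma)|^2(1+\ell(\gamma))^{2s}\Big)^{1/2},\ \sup_{u}\Big(\sum_{r(\gamma)=u}|f(\gamma)|^2(1+\ell(\gamma))^{2s}\Big)^{1/2}\Big\}.$$ Here the suprema run over $u\in\mathcal G^{(0)}$, and $\Lambda(f)\xi=f*\xi$ is the left regular representation on the Hilbert $C(\mathcal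 G^{(0)})$-module completing $C_c(\mathcal G)$ in the norm $\|\xi\|=\sup_u\big(\sum_{\gamma\in\mathcal G_u}|\xi(\gamma)|^2\big)^{1/2}$. -/

import Mathlib

open scoped ENNReal CompactlySupported

universe u v w

/-! ## Groupoids, growth and rapid decay -/

/-- A groupoid, presented by its set `G` of arrows. The units are arrows, `γ μ` is defined when
`src γ = rng μ`, and `src γ = γ⁻¹ γ`, `rng γ = γ γ⁻¹`. -/
class ArrowGroupoid (G : Type u) where
  src : G → G
  rng : G → G
  inv : G → G
  mul : (γ μ : G) → src γ = rng μ → G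
  rng_src : ∀ γ, rng (src γ) = src γ
  src_rng : ∀ γ, src (rng γ) = rng γ
  src_inv : ∀ γ, src (inv γ) = rng γ
  rng_inv : ∀ γ, rng (inv γ) = src γ
  src_mul : ∀ γ μ h, src (mul γ μ h) = src μ
  rng_mul : ∀ γ μ h, rng (mul γ μ h) = rng γ
  mul_src : ∀ γ, mul γ (src γ) (rng_src γ).symm = γ
  rng_mul_self : ∀ γ, mul (rng γ) γ (src_rng γ) = γ
  inv_mul_self : ∀ γ, mul (inv γ) γ (src_inv γ) = src γ
  mul_inv_self : ∀ γ, mul γ (inv γ) (rng_inv γ).symm = rng γ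
  mul_assoc : ∀ γ μ ν (h : src γ = rng μ) (h' : src μ = rng ν),
    mul (mul γ μ h) ν ((src_mul γ μ h).trans h') = mul γ (mul μ ν h') (h.trans (rng_mul μ ν h').symm)

namespace ArrowGroupoid

/-- The unit space `G⁽⁰⁾`, as a subset of `G`. -/
def units (G : Type u) [ArrowGroupoid G] : Set G := Set.range (src : G → G)

section Fibers
variable {G : Type u} [ArrowGroupoid G]

/-- The source fiber `G_u`. -/
def srcFiber (x : G) : Set G := {γ | src γ = x}

/-- The range fiber `G^u`. -/
def rngFiber (x : G) : Set G := {γ | rng γ = x}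

/-- `ℓ` has linear growth: there is a real polynomial `p` of degree at most one with
`|{γ ∈ G_u | ℓ γ ≤ t}| ≤ p t` for all `t ≥ 0` and all units `u`. -/
def HasLinearGrowth (ℓ : G → ℝ) : Prop :=
  ∃ p : Polynomial ℝ, p.natDegree ≤ 1 ∧ ∀ t : ℝ, 0 ≤ t → ∀ x ∈ units G,
    (srcFiber x ∩ {γ | ℓ γ ≤ t}).Finite ∧
      ((srcFiber x ∩ {γ | ℓ γ ≤ t}).ncard : ℝ) ≤ p.eval t

/-- Convolution, `(f * g)(γ) = ∑_{μ ∈ G_{s(γ)}} f (γ μ⁻¹) g μ`. When `f` and `g` are compactly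
supported on an étale groupoid, the sum has finitely many nonzero terms. -/
noncomputable def conv (f g : G → ℂ) (γ : G) : ℂ :=
  ∑' μ : srcFiber (src γ),
    f (mul γ (inv μ.1) ((rng_inv μ.1).trans μ.2).symm) * g μ.1

/-- The norm `ξ ↦ ‖⟨ξ, ξ⟩‖_∞ ^ (1/2)` of the Hilbert module completing `C_c(G)`, where
`⟨ξ, ξ⟩(u) = ∑_{μ ∈ G_u} |ξ μ|²`. -/
noncomputable def moduleNorm (ξ : G → ℂ) : ℝ≥0∞ :=
  (⨆ x ∈ units G, ∑' μ : srcFiber x, ‖ξ μ.1‖ₑ ^ 2) ^ (1 / 2 : ℝ)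

/-- The norm `‖f‖_{2,s}`. -/
noncomputable def weightedNorm (ℓ : G → ℝ) (s : ℝ) (f : G → ℂ) : ℝ≥0∞ :=
  max
    (⨆ x ∈ units G,
      (∑' γ : srcFiber x, ‖f γ.1‖ₑ ^ 2 * ENNReal.ofReal ((1 + ℓ γ.1) ^ (2 * s))) ^ (1 / 2 : ℝ))
    (⨆ x ∈ units G,
      (∑' γ : rngFiber x, ‖f γ.1‖ₑ ^ 2 * ENNReal.ofReal ((1 + ℓ γ.1) ^ (2 * s))) ^ (1 / 2 : ℝ))

variable [TopologicalSpace G]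

/-- The reduced norm `‖Λ(f)‖`: the operator norm of `ξ ↦ f * ξ` with respect to the Hilbert module
norm. The supremum runs over the unit ball of `C_c(G)`, which is dense in the unit ball of the
Hilbert module, so it is the norm of the bounded extension of `Λ(f)` to that module. -/
noncomputable def reducedNorm (f : C_c(G, ℂ)) : ℝ≥0∞ :=
  ⨆ (ξ : C_c(G, ℂ)) (_ : moduleNorm (ξ : G → ℂ) ≤ 1), moduleNorm (conv (f : G → ℂ) (ξ : G → ℂ))

/-- `(G, ℓ)` has rapid decay: `‖Λ(f)‖ ≤ C ‖f‖_{2,s}` on `C_c(G)` for some `C, s ≥ 0`. -/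
def HasRapidDecay (ℓ : G → ℝ) : Prop :=
  ∃ C s : ℝ, 0 ≤ C ∧ 0 ≤ s ∧ ∀ f : C_c(G, ℂ),
    reducedNorm f ≤ ENNReal.ofReal C * weightedNorm ℓ s (f : G → ℂ)

end Fibers

/-- An isomorphism of topological groupoids. -/
structure TopIso (G : Type u) (H : Type v) [ArrowGroupoid G] [TopologicalSpace G]
    [ArrowGroupoid H] [TopologicalSpace H] extends G ≃ₜ H where
  map_src : ∀ γ, toFun (src γ) = src (toFun γ)
  map_rng : ∀ γ, toFun (rng γ) = rng (toFun γ)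
  map_mul : ∀ γ μ (h : src γ = rng μ),
    toFun (mul γ μ h) =
      mul (toFun γ) (toFun μ) ((map_src γ).symm.trans ((congrArg toFun h).trans (map_rng μ)))

end ArrowGroupoid

/-! ## Bratteli diagrams -/

/-- A Bratteli diagram. The edges in `E n` run from level `n` to level `n + 1`, so that `E n` is
the edge set often written `E_{n+1}`; it is nonempty since `i` is surjective. -/
structure BratteliDiagram where
  V : ℕ → Type v
  E : ℕ → Type w
  finite_V : ∀ n, Finite (V n)
  nonempty_V : ∀ n, Nonempty (V n)
  finite_E : ∀ n, Finite (E n)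
  i : ∀ {n}, E n → V n
  t : ∀ {n}, E n → V (n + 1)
  i_surjective : ∀ n, Function.Surjective (i : E n → V n)

namespace BratteliDiagram

section Diagram
variable (B : BratteliDiagram.{v, w})

/-- A vertex together with its level. -/
def Vertex : Type v := Σ n, B.V n

/-- The set `S(B)` of sources: vertices at which no edge ends. -/
def sources : Set B.Vertex := {x | ∀ (n : ℕ) (e : B.E n), (⟨n + 1, B.t e⟩ : Σ n, B.V n) ≠ x}

/-- The set `P(x, V_n)` of finite paths from the vertex `x` to level `n`; when `x` is itself at
level `n`, this consists of the path of length zero. -/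
@[ext]
structure FinPath (x : B.Vertex) (n : ℕ) where
  le : x.1 ≤ n
  edge : ∀ k, x.1 ≤ k → k < n → B.E k
  first : ∀ h : x.1 < n, B.i (edge x.1 le_rfl h) = x.2
  comp : ∀ k (h : x.1 ≤ k) (h' : k + 1 < n),
    B.i (edge (k + 1) (h.trans k.le_succ) h') = B.t (edge k h (k.lt_succ_self.trans h'))

/-- The space `X_B` of infinite paths that start at a source. -/
@[ext]
structure InfPath where
  source : B.Vertex
  source_mem : source ∈ B.sources
  edge : ∀ k, source.1 ≤ k → B.E k
  first : B.i (edge source.1 le_rfl) = source.2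
  comp : ∀ k (h : source.1 ≤ k), B.i (edge (k + 1) (h.trans k.le_succ)) = B.t (edge k h)

variable {B}

/-- The cylinder set `Z(μ)`. -/
def cylinder {a : B.Vertex} {n : ℕ} (μ : B.FinPath a n) : Set B.InfPath :=
  {x | x.source = a ∧
    ∀ k (hx : x.source.1 ≤ k) (ha : a.1 ≤ k) (hn : k < n), x.edge k hx = μ.edge k ha hn}

/-- The topology of `X_B` generated by the cylinder sets of finite paths starting at sources. -/
instance : TopologicalSpace B.InfPath :=
  TopologicalSpace.generateFrom
    {U | ∃ a ∈ B.sources, ∃ (n : ℕ) (μ : B.FinPath a n), U = cylinder μ}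

variable (B)

/-- The set `P_N` of pairs of paths that start at level at most `N` and have the same edges beyond
level `N`. -/
def tailRel (N : ℕ) : Set (B.InfPath × B.InfPath) :=
  {p | ∃ (hx : p.1.source.1 ≤ N) (hy : p.2.source.1 ≤ N),
    ∀ k (hk : N ≤ k), p.1.edge k (hx.trans hk) = p.2.edge k (hy.trans hk)}

variable {B}

theorem tailRel_refl (x : B.InfPath) : (x, x) ∈ B.tailRel x.source.1 :=
  ⟨le_rfl, le_rfl, fun _ _ => rfl⟩

theorem tailRel_symm {N : ℕ} {x y : B.InfPath} (h : (x, y) ∈ B.tailRel N) :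
    (y, x) ∈ B.tailRel N :=
  let ⟨hx, hy, he⟩ := h
  ⟨hy, hx, fun k hk => (he k hk).symm⟩

theorem tailRel_trans {N M : ℕ} {x y z : B.InfPath} (h : (x, y) ∈ B.tailRel N)
    (h' : (y, z) ∈ B.tailRel M) : (x, z) ∈ B.tailRel (max N M) :=
  let ⟨hx, _, he⟩ := h
  let ⟨_, hz, he'⟩ := h'
  ⟨hx.trans (le_max_left _ _), hz.trans (le_max_right _ _), fun k hk =>
    (he k ((le_max_left _ _).trans hk)).trans (he' k ((le_max_right _ _).trans hk))⟩

variable (B)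

/-- The groupoid `G_B`, as a set: the union of the sets `P_N`. -/
def PathGroupoid : Type (max v w) :=
  {p : B.InfPath × B.InfPath // ∃ N, p ∈ B.tailRel N}

/-- The inclusion of `P_N` into `G_B`. -/
def tailInclusion (N : ℕ) (p : B.tailRel N) : B.PathGroupoid := ⟨p.1, N, p.2⟩

/-- The inductive limit topology of `G_B`: a set is open if and only if its intersection with each
`P_N` is open in the topology that `P_N` inherits from the product `X_B × X_B`. -/
instance : TopologicalSpace B.PathGroupoid :=
  ⨆ N, TopologicalSpace.coinduced (B.tailInclusion N) inferInstance

/-- The groupoid operations `(x, y) (y, z) = (x, z)` and `(x, y)⁻¹ = (y, x)`; the unit `(x, x)`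
corresponds to the path `x`. -/
instance : ArrowGroupoid B.PathGroupoid where
  src γ := ⟨(γ.1.2, γ.1.2), _, tailRel_refl γ.1.2⟩
  rng γ := ⟨(γ.1.1, γ.1.1), _, tailRel_refl γ.1.1⟩
  inv γ := ⟨(γ.1.2, γ.1.1), γ.2.imp fun _ h => tailRel_symm h⟩
  mul γ μ h := ⟨(γ.1.1, μ.1.2), by
    have h1 : γ.1.2 = μ.1.1 := congrArg (fun x : B.PathGroupoid => x.1.1) h
    obtain ⟨N, hN⟩ := γ.2
    obtain ⟨M, hM⟩ := μ.2
    refine ⟨max N M, tailRel_trans (y := γ.1.2) hN ?_⟩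
    rw [h1]
    exact hM⟩
  rng_src _ := rfl
  src_rng _ := rfl
  src_inv _ := rfl
  rng_inv _ := rfl
  src_mul _ _ _ := rfl
  rng_mul _ _ _ := rfl
  mul_src _ := rfl
  rng_mul_self _ := rfl
  inv_mul_self _ := rfl
  mul_inv_self _ := rfl
  mul_assoc _ _ _ _ _ := rfl

variable {B}

/-- `k(x, y)`, the least level beyond which `x` and `y` coincide. -/
noncomputable def agreeLevel (γ : B.PathGroupoid) : ℕ := sInf {m | γ.1 ∈ B.tailRel m}

open Classical in
/-- The length function of the Bratteli diagram: `ℓ(x, x) = 0` and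
`ℓ(x, y) = ∑_{a ∈ S(B)} |P(a, V_{k(x, y)})|` for `x ≠ y`. -/
noncomputable def length (γ : B.PathGroupoid) : ℝ :=
  if γ.1.1 = γ.1.2 then 0
  else ((∑ᶠ a : B.sources, Nat.card (B.FinPath a.1 (agreeLevel γ)) : ℕ) : ℝ)

end Diagram

end BratteliDiagram

/-! Growth: fix `y` and a finite set of arrows `(x, y)` of length at most `M`. If one is not a unit,
let `n` be the largest `k(x, y)` among the non-units. All the arrows then lie in `P_n`, so each `x`
follows `y` beyond level `n` and is determined by its initial segment, a finite path from a source
to level `n`. The number of such paths is the length of the arrow attaining `n`, hence at most `M`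
(`card_le_of_length_le`).

Rapid decay: linear growth bounds `∑ (1 + ℓ)⁻⁴` uniformly on fibers, so by Cauchy–Schwarz the
`ℓ¹`-norm of `f` on each source and range fiber is at most a constant times `‖f‖_{2,2}`. These fiber
norms bound the columns and rows of the kernel `f (γ μ⁻¹)`, and Schur's test bounds the operator
(`moduleNorm_conv_le`). -/

/-! ### Cauchy–Schwarz and Schur's test for sums in `[0, ∞]` -/

namespace ENNReal

/-- The weighted Cauchy–Schwarz inequality. -/
theorem tsum_mul_sq_le {ι : Type*} (k g : ι → ℝ≥0∞) :
    (∑' i, k i * g i) ^ 2 ≤ (∑' i, k i) * ∑' i, k i * g i ^ 2 := by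
  have key : ∑' i, k i * g i ≤ ((∑' i, k i) * ∑' i, k i * g i ^ 2) ^ (1 / 2 : ℝ) := by
    rw [ENNReal.tsum_eq_iSup_sum]
    refine iSup_le fun s => ?_
    refine (ENNReal.inner_le_weight_mul_Lp_of_nonneg s (p := 2) one_le_two k g).trans ?_
    rw [ENNReal.mul_rpow_of_nonneg _ _ (by norm_num : (0 : ℝ) ≤ 1 / 2)]
    norm_num only [one_div]
    gcongr
    · exact ENNReal.sum_le_tsum s
    · simpa only [ENNReal.rpow_two] using ENNReal.sum_le_tsum (f := fun i => k i * g i ^ 2) s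
  calc (∑' i, k i * g i) ^ 2
      ≤ (((∑' i, k i) * ∑' i, k i * g i ^ 2) ^ (1 / 2 : ℝ)) ^ 2 := by gcongr
    _ = (∑' i, k i) * ∑' i, k i * g i ^ 2 := by
      rw [← ENNReal.rpow_two, ← ENNReal.rpow_mul]; norm_num

/-- Schur's test. -/
theorem tsum_sq_tsum_mul_le {α β : Type*} (k : α → β → ℝ≥0∞) (g : β → ℝ≥0∞) {a b : ℝ≥0∞}
    (ha : ∀ x, ∑' y, k x y ≤ a) (hb : ∀ y, ∑' x, k x y ≤ b) :
    ∑' x, (∑' y, k x y * g y) ^ 2 ≤ a * b * ∑' y, g y ^ 2 := by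
  calc ∑' x, (∑' y, k x y * g y) ^ 2
      ≤ ∑' x, a * ∑' y, k x y * g y ^ 2 := by
        -- The row `k x` serves as the weight: its sum factors out as `a`, and column sums appear
        -- after interchanging.
        refine ENNReal.tsum_le_tsum fun x => (tsum_mul_sq_le _ _).trans ?_
        gcongr
        exact ha x
    _ = a * ∑' y, (∑' x, k x y) * g y ^ 2 := by
        rw [ENNReal.tsum_mul_left, ENNReal.tsum_comm]
        simp_rw [ENNReal.tsum_mul_right]
    _ ≤ a * ∑' y, b * g y ^ 2 := by
        gcongr with y
        exact hb y
    _ = a * b * ∑' y, g y ^ 2 := by rw [ENNReal.tsum_mul_left, mul_assoc]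

end ENNReal

/-! ### Summability from linear growth -/

/-- The constant bounding `∑ (1 + ℓ)⁻⁴` for a function `ℓ` of linear growth. -/
noncomputable def linearGrowthConst : ℝ≥0∞ :=
  ∑' n : ℕ, ENNReal.ofReal ((n + 2) / (n + 1) ^ 4)

theorem linearGrowthConst_ne_top : linearGrowthConst ≠ ∞ := by
  refine Summable.tsum_ofReal_ne_top ?_
  -- Comparison with `2 / (n + 1)³`, since `n + 2 ≤ 2 (n + 1)`.
  have h : Summable fun n : ℕ => 2 * (1 / ((n + 1 : ℕ) : ℝ) ^ 3) :=
    ((summable_nat_add_iff 1).2 (Real.summable_one_div_nat_pow.2 (by norm_num : 1 < 3))).mul_left 2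
  refine h.of_nonneg_of_le (fun n => by positivity) fun n => ?_
  have hn : (0 : ℝ) ≤ n := n.cast_nonneg
  push_cast
  rw [div_le_iff₀ (by positivity)]
  have : 2 * (1 / ((n : ℝ) + 1) ^ 3) * ((n : ℝ) + 1) ^ 4 = 2 * (n + 1) := by
    field_simp
  rw [this]
  linarith

/-- On the shell `n ≤ ℓ < n + 1` the summand is at most `1 / (n + 1)⁴`, and the shell has at most `1
+ (n + 1)` elements. -/
theorem tsum_inv_pow_le_linearGrowthConst {G : Type*} (S : Set G) (ℓ : G → ℝ) (h₀ : ∀ γ, 0 ≤ ℓ γ)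
    (h : ∀ t : ℝ, 0 ≤ t → (S ∩ {γ | ℓ γ ≤ t}).Finite ∧
      ((S ∩ {γ | ℓ γ ≤ t}).ncard : ℝ) ≤ 1 + t) :
    ∑' γ : S, (ENNReal.ofReal ((1 + ℓ γ.1) ^ 4))⁻¹ ≤ linearGrowthConst := by
  have count (n : ℕ) : ∑' γ : S, Set.indicator {γ : G | ℓ γ ≤ n + 1} (1 : G → ℝ≥0∞) γ
      ≤ ENNReal.ofReal (n + 2) := by
    obtain ⟨hf, hc⟩ := h (n + 1) (by positivity)
    rw [tsum_subtype S, Set.indicator_indicator, ← tsum_subtype]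
    simp only [Pi.one_apply, ENNReal.tsum_set_one]
    rw [← hf.cast_ncard_eq]
    simp only [ENat.toENNReal_coe]
    rw [← ENNReal.ofReal_natCast]
    exact ENNReal.ofReal_le_ofReal (by linarith)
  calc ∑' γ : S, (ENNReal.ofReal ((1 + ℓ γ.1) ^ 4))⁻¹
      ≤ ∑' γ : S, ∑' n : ℕ, ENNReal.ofReal (1 / (n + 1) ^ 4) *
          Set.indicator {γ : G | ℓ γ ≤ n + 1} (1 : G → ℝ≥0∞) γ := by
        refine ENNReal.tsum_le_tsum fun γ => ?_
        -- The single term `n = ⌊ℓ γ⌋` already dominates.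
        refine le_trans ?_ (ENNReal.le_tsum ⌊ℓ γ.1⌋₊)
        have h1 : γ.1 ∈ {μ : G | ℓ μ ≤ (⌊ℓ γ.1⌋₊ : ℝ) + 1} := 
          (Nat.lt_floor_add_one (ℓ γ.1)).le
        rw [Set.indicator_of_mem h1, Pi.one_apply, mul_one,
          ← ENNReal.ofReal_inv_of_pos (by have := h₀ γ.1; positivity), one_div]
        refine ENNReal.ofReal_le_ofReal ?_
        have := Nat.floor_le (h₀ γ.1)
        rw [add_comm 1 (ℓ γ.1)]
        gcongr
    _ = ∑' n : ℕ, ENNReal.ofReal (1 / (n + 1) ^ 4) *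
          ∑' γ : S, Set.indicator {γ : G | ℓ γ ≤ n + 1} (1 : G → ℝ≥0∞) γ := by
        rw [ENNReal.tsum_comm]
        simp_rw [ENNReal.tsum_mul_left]
    _ ≤ linearGrowthConst := by
        refine ENNReal.tsum_le_tsum fun n => ?_
        refine (mul_le_mul_right (count n) _).trans_eq ?_
        rw [← ENNReal.ofReal_mul (by positivity)]
        congr 1
        ring

/-- If `ℓ` has linear growth, a weighted `ℓ²`-norm dominates the `ℓ¹`-norm. -/
theorem tsum_enorm_sq_le_of_linear_growth {G : Type*} (S : Set G) (ℓ : G → ℝ) (h₀ : ∀ γ, 0 ≤ ℓ γ)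
    (h : ∀ t : ℝ, 0 ≤ t → (S ∩ {γ | ℓ γ ≤ t}).Finite ∧
      ((S ∩ {γ | ℓ γ ≤ t}).ncard : ℝ) ≤ 1 + t) (f : G → ℂ) :
    (∑' γ : S, ‖f γ.1‖ₑ) ^ 2 ≤
      linearGrowthConst * ∑' γ : S, ‖f γ.1‖ₑ ^ 2 * ENNReal.ofReal ((1 + ℓ γ.1) ^ 4) := by
  have hw (γ : S) : ENNReal.ofReal ((1 + ℓ γ.1) ^ 4) ≠ 0 := by
    have := h₀ γ.1
    rw [ENNReal.ofReal_ne_zero_iff]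
    positivity
  have cancel (γ : S) : (ENNReal.ofReal ((1 + ℓ γ.1) ^ 4))⁻¹ * ENNReal.ofReal ((1 + ℓ γ.1) ^ 4) = 1 :=
    ENNReal.inv_mul_cancel (hw γ) ENNReal.ofReal_ne_top
  calc (∑' γ : S, ‖f γ.1‖ₑ) ^ 2
      -- With `w = (1 + ℓ)⁴`, write `|f| = w⁻¹ (w |f|)` and apply Cauchy–Schwarz with weight `w⁻¹`;
      -- then `w⁻¹ (w |f|)² = w |f|²`.
      = (∑' γ : S, (ENNReal.ofReal ((1 + ℓ γ.1) ^ 4))⁻¹ *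
          (ENNReal.ofReal ((1 + ℓ γ.1) ^ 4) * ‖f γ.1‖ₑ)) ^ 2 := by
        congr 2 with γ
        rw [← mul_assoc, cancel, one_mul]
    _ ≤ _ := ENNReal.tsum_mul_sq_le _ _
    _ ≤ linearGrowthConst * ∑' γ : S, (ENNReal.ofReal ((1 + ℓ γ.1) ^ 4))⁻¹ *
          (ENNReal.ofReal ((1 + ℓ γ.1) ^ 4) * ‖f γ.1‖ₑ) ^ 2 := by
        gcongr
        exact tsum_inv_pow_le_linearGrowthConst S ℓ h₀ h
    _ = _ := by
        congr 2 with γ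
        rw [mul_pow, pow_two (ENNReal.ofReal _), ← mul_assoc, ← mul_assoc, cancel, one_mul, mul_comm]

/-! ### Convolution operators on groupoids -/

namespace ArrowGroupoid

variable {G : Type u} [ArrowGroupoid G]

/-- Products carry a proof of composability, which blocks rewriting a factor in place. -/
theorem mul_congr {γ γ' μ μ' : G} (h : src γ = rng μ) (hγ : γ = γ') (hμ : μ = μ') :
    mul γ μ h = mul γ' μ' (by rw [← hγ, ← hμ, h]) := by
  subst hγ hμ; rfl

theorem mul_left_cancel {γ μ ν : G} (h : src γ = rng μ) (h' : src γ = rng ν)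
    (e : mul γ μ h = mul γ ν h') : μ = ν := by
  have key (κ : G) (hκ : src γ = rng κ) :
      mul (inv γ) (mul γ κ hκ) ((src_inv γ).trans (rng_mul γ κ hκ).symm) = κ := by
    rw [← mul_assoc (inv γ) γ κ (src_inv γ) hκ, mul_congr _ ((inv_mul_self γ).trans hκ) rfl,
      rng_mul_self]
  rw [← key μ h, ← key ν h']
  exact mul_congr _ rfl e

theorem mul_right_cancel {γ μ ν : G} (h : src μ = rng γ) (h' : src ν = rng γ)
    (e : mul μ γ h = mul ν γ h') : μ = ν := by
  have key (κ : G) (hκ : src κ = rng γ) :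
      mul (mul κ γ hκ) (inv γ) ((src_mul κ γ hκ).trans (rng_inv γ).symm) = κ := by
    rw [mul_assoc κ γ (inv γ) hκ (rng_inv γ).symm,
      mul_congr _ rfl ((mul_inv_self γ).trans hκ.symm), mul_src]
  rw [← key μ h, ← key ν h']
  exact mul_congr _ e rfl

theorem inv_injective : Function.Injective (inv : G → G) := by
  intro γ μ e
  have hs : rng γ = rng μ := by rw [← src_inv, ← src_inv, e]
  have hr : src γ = src μ := by rw [← rng_inv, ← rng_inv, e]
  refine mul_left_cancel (γ := inv γ) (src_inv γ) ((src_inv γ).trans hs) ?_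
  rw [inv_mul_self, mul_congr _ e rfl, inv_mul_self, hr]

/-- The quotient `γ μ⁻¹` of two arrows with the same source. -/
def div {x : G} (γ μ : srcFiber x) : G :=
  mul γ.1 (inv μ.1) (γ.2.trans (μ.2.symm.trans (rng_inv μ.1).symm))

theorem rng_div {x : G} (γ μ : srcFiber x) : rng (div γ μ) = rng γ.1 := rng_mul _ _ _

theorem src_div {x : G} (γ μ : srcFiber x) : src (div γ μ) = rng μ.1 :=
  (src_mul _ _ _).trans (src_inv _)

theorem rng_mem_units (γ : G) : rng γ ∈ units G := ⟨rng γ, src_rng γ⟩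

/-- By cancellation `μ ↦ γ μ⁻¹` is injective into the range fiber of `rng γ`. This bounds the rows
of the convolution kernel; the next lemma bounds its columns. -/
theorem tsum_div_le_rngFiber {x : G} (F : G → ℝ≥0∞) (γ : srcFiber x) :
    ∑' μ : srcFiber x, F (div γ μ) ≤ ∑' ν : rngFiber (rng γ.1), F ν.1 := by
  refine ENNReal.tsum_comp_le_tsum_of_injective
    (f := fun μ : srcFiber x => (⟨div γ μ, rng_div γ μ⟩ : rngFiber (rng γ.1)))
    (fun μ ν e => ?_) (fun ν => F ν.1)
  exact Subtype.ext (inv_injective (mul_left_cancel _ _ (congrArg Subtype.val e)))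

theorem tsum_div_le_srcFiber {x : G} (F : G → ℝ≥0∞) (μ : srcFiber x) :
    ∑' γ : srcFiber x, F (div γ μ) ≤ ∑' ν : srcFiber (rng μ.1), F ν.1 := by
  refine ENNReal.tsum_comp_le_tsum_of_injective
    (f := fun γ : srcFiber x => (⟨div γ μ, src_div γ μ⟩ : srcFiber (rng μ.1)))
    (fun γ ν e => ?_) (fun ν => F ν.1)
  exact Subtype.ext (mul_right_cancel _ _ (congrArg Subtype.val e))

theorem enorm_conv_le (f g : G → ℂ) {x : G} (γ : srcFiber x) :
    ‖conv f g γ.1‖ₑ ≤ ∑' μ : srcFiber x, ‖f (div γ μ)‖ₑ * ‖g μ.1‖ₑ := by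
  obtain ⟨γ, rfl⟩ := γ
  refine enorm_tsum_le_tsum_enorm.trans (ENNReal.tsum_le_tsum fun μ => ?_)
  rw [enorm_mul]
  rfl

/-- The module norm of a convolution is controlled by the `I`-norm of the left factor. -/
theorem moduleNorm_conv_le (f g : G → ℂ) {a : ℝ≥0∞}
    (hs : ∀ x ∈ units G, ∑' γ : srcFiber x, ‖f γ.1‖ₑ ≤ a)
    (hr : ∀ x ∈ units G, ∑' γ : rngFiber x, ‖f γ.1‖ₑ ≤ a) :
    moduleNorm (conv f g) ≤ a * moduleNorm g := by
  -- Both Schur constants equal `a`, so the square root of their product is `a`.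
  have ha : a = (a * a) ^ (1 / 2 : ℝ) := by
    rw [← pow_two, ← ENNReal.rpow_two, ← ENNReal.rpow_mul]; norm_num
  unfold moduleNorm
  conv_rhs => rw [ha, ← ENNReal.mul_rpow_of_nonneg _ _ (by norm_num : (0 : ℝ) ≤ 1 / 2)]
  refine ENNReal.rpow_le_rpow (iSup₂_le fun x hx => ?_) (by norm_num)
  calc ∑' γ : srcFiber x, ‖conv f g γ.1‖ₑ ^ 2
      ≤ ∑' γ : srcFiber x, (∑' μ : srcFiber x, ‖f (div γ μ)‖ₑ * ‖g μ.1‖ₑ) ^ 2 :=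
        ENNReal.tsum_le_tsum fun γ => pow_le_pow_left' (enorm_conv_le f g γ) 2
    _ ≤ a * a * ∑' μ : srcFiber x, ‖g μ.1‖ₑ ^ 2 :=
        ENNReal.tsum_sq_tsum_mul_le _ _
          (fun γ => (tsum_div_le_rngFiber (fun ν => ‖f ν‖ₑ) γ).trans (hr _ (rng_mem_units _)))
          (fun μ => (tsum_div_le_srcFiber (fun ν => ‖f ν‖ₑ) μ).trans (hs _ (rng_mem_units _)))
    _ ≤ _ := by
        gcongr
        exact le_iSup₂ (f := fun x (_ : x ∈ units G) => ∑' μ : srcFiber x, ‖g μ.1‖ₑ ^ 2) x hx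

/-- Linear growth along source and range fibers implies rapid decay. -/
theorem hasRapidDecay_of_linear_growth [TopologicalSpace G] {ℓ : G → ℝ} (h₀ : ∀ γ, 0 ≤ ℓ γ)
    (hs : ∀ t : ℝ, 0 ≤ t → ∀ x ∈ units G, (srcFiber x ∩ {γ | ℓ γ ≤ t}).Finite ∧
      ((srcFiber x ∩ {γ | ℓ γ ≤ t}).ncard : ℝ) ≤ 1 + t)
    (hr : ∀ t : ℝ, 0 ≤ t → ∀ x ∈ units G, (rngFiber x ∩ {γ | ℓ γ ≤ t}).Finite ∧
      ((rngFiber x ∩ {γ | ℓ γ ≤ t}).ncard : ℝ) ≤ 1 + t) :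
    HasRapidDecay ℓ := by
  -- The choice `s = 2` makes the weight `(1 + ℓ)^(2s)` the fourth power in `linearGrowthConst`; the
  -- square root comes from Cauchy–Schwarz.
  refine ⟨(linearGrowthConst ^ (1 / 2 : ℝ)).toReal, 2, ENNReal.toReal_nonneg, by norm_num,
    fun f => iSup₂_le fun ξ hξ => ?_⟩
  rw [ENNReal.ofReal_toReal (ENNReal.rpow_ne_top_of_nonneg (by norm_num) linearGrowthConst_ne_top)]
  have hpow (γ : G) : (1 + ℓ γ) ^ (2 * 2 : ℝ) = (1 + ℓ γ) ^ 4 := by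
    rw [← Real.rpow_natCast]; norm_num
  have hfib (S : Set G) (h : ∀ t : ℝ, 0 ≤ t → (S ∩ {γ | ℓ γ ≤ t}).Finite ∧
      ((S ∩ {γ | ℓ γ ≤ t}).ncard : ℝ) ≤ 1 + t) :
      ∑' γ : S, ‖f γ.1‖ₑ ≤ linearGrowthConst ^ (1 / 2 : ℝ) *
        (∑' γ : S, ‖f γ.1‖ₑ ^ 2 * ENNReal.ofReal ((1 + ℓ γ.1) ^ (2 * 2 : ℝ))) ^ (1 / 2 : ℝ) := by
    rw [← ENNReal.mul_rpow_of_nonneg _ _ (by norm_num : (0 : ℝ) ≤ 1 / 2), one_div,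
      ENNReal.le_rpow_inv_iff (by norm_num), ENNReal.rpow_two]
    simp_rw [hpow]
    exact tsum_enorm_sq_le_of_linear_growth S ℓ h₀ h f
  calc moduleNorm (conv f ξ)
      ≤ linearGrowthConst ^ (1 / 2 : ℝ) * weightedNorm ℓ 2 f * moduleNorm (ξ : G → ℂ) := by
        refine moduleNorm_conv_le _ _ (fun x hx => ?_) (fun x hx => ?_)
        · refine (hfib _ fun t ht => hs t ht x hx).trans ?_
          gcongr
          exact le_max_of_le_left (le_iSup₂ (f := fun x (_ : x ∈ units G) => (∑' γ : srcFiber x,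
            ‖f γ.1‖ₑ ^ 2 * ENNReal.ofReal ((1 + ℓ γ.1) ^ (2 * 2 : ℝ))) ^ (1 / 2 : ℝ)) x hx)
        · refine (hfib _ fun t ht => hr t ht x hx).trans ?_
          gcongr
          exact le_max_of_le_right (le_iSup₂ (f := fun x (_ : x ∈ units G) => (∑' γ : rngFiber x,
            ‖f γ.1‖ₑ ^ 2 * ENNReal.ofReal ((1 + ℓ γ.1) ^ (2 * 2 : ℝ))) ^ (1 / 2 : ℝ)) x hx)
    _ ≤ linearGrowthConst ^ (1 / 2 : ℝ) * weightedNorm ℓ 2 f :=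
        mul_le_of_le_one_right' hξ

end ArrowGroupoid

/-! ### Counting paths in a Bratteli diagram -/

namespace BratteliDiagram

variable {B : BratteliDiagram.{v, w}}

theorem tailRel_mono {m n : ℕ} (h : m ≤ n) : B.tailRel m ⊆ B.tailRel n :=
  fun _ ⟨hx, hy, he⟩ => ⟨hx.trans h, hy.trans h, fun k hk => he k (h.trans hk)⟩

/-- The infimum is attained because every arrow lies in some `P_N`, so the default value of `sInf ∅`
never occurs. -/
theorem mem_tailRel_agreeLevel (γ : B.PathGroupoid) : γ.1 ∈ B.tailRel (agreeLevel γ) :=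
  Nat.sInf_mem (s := {m | γ.1 ∈ B.tailRel m}) γ.2

theorem InfPath.ext_edge {x y : B.InfPath} (h : x.source = y.source)
    (he : ∀ k (hx : x.source.1 ≤ k) (hy : y.source.1 ≤ k), x.edge k hx = y.edge k hy) : x = y := by
  obtain ⟨a, _, e, _, _⟩ := x
  obtain ⟨b, _, e', _, _⟩ := y
  obtain rfl : a = b := h
  obtain rfl : e = e' := by
    funext k hk
    exact he k hk hk
  rfl

/-- The initial segment up to level `n` of an infinite path that starts at `a`. -/
def InfPath.truncate (x : B.InfPath) {a : B.Vertex} (h : x.source = a) (n : ℕ) (hn : a.1 ≤ n) :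
    B.FinPath a n where
  le := hn
  edge k hk _ := x.edge k (h ▸ hk)
  first _ := by subst h; exact x.first
  comp k hk _ := x.comp k (h ▸ hk)

/-- A path is encoded by its finitely many edges. Without finiteness `Nat.card` would be `0` and the
counting bound would fail. -/
instance (a : B.Vertex) (n : ℕ) : Finite (B.FinPath a n) := by
  have := B.finite_E
  refine Finite.of_injective
    (fun (μ : B.FinPath a n) (k : Fin n) (h : a.1 ≤ k) => μ.edge k h k.2) fun μ ν e => ?_
  ext k hk hn
  exact congrFun (congrFun e ⟨k, hn⟩) hk

theorem finite_vertices_le (B : BratteliDiagram.{v, w}) (n : ℕ) :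
    {a : B.Vertex | a.1 ≤ n}.Finite := by
  have := B.finite_V
  refine (Set.finite_range fun p : Σ k : Fin (n + 1), B.V k => (⟨p.1, p.2⟩ : B.Vertex)).subset ?_
  rintro ⟨k, a⟩ hk
  exact ⟨⟨⟨k, Nat.lt_succ_of_le hk⟩, a⟩, rfl⟩

/-- A set of infinite paths that agree beyond level `n` has at most as many elements as there are
finite paths from the sources to level `n`. -/
theorem card_le_finsum_card_finPath {n : ℕ} {y : B.InfPath} (F : Finset B.InfPath)
    (hF : ∀ x ∈ F, (x, y) ∈ B.tailRel n) :
    F.card ≤ ∑ᶠ a : B.sources, Nat.card (B.FinPath a.1 n) := by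
  classical
  -- A `finsum` with infinite support would be `0`; here only sources at level at most `n`
  -- contribute.
  have hfin : {a : B.sources | a.1.1 ≤ n}.Finite :=
    (B.finite_vertices_le n).preimage Subtype.val_injective.injOn
  rw [finsum_eq_sum_of_support_subset (s := hfin.toFinset) _ fun a ha => by
    obtain ⟨⟨μ⟩, -⟩ := Nat.card_ne_zero.1 ha
    simpa using μ.le]
  rw [Finset.card_eq_sum_card_fiberwise
    (f := fun x : B.InfPath => (⟨x.source, x.source_mem⟩ : B.sources)) (t := hfin.toFinset)
    fun x hx => by simpa using (hF x hx).1]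
  refine Finset.sum_le_sum fun a ha => ?_
  have han : a.1.1 ≤ n := by simpa using ha
  have hsrc (x : {x ∈ F | (⟨x.source, x.source_mem⟩ : B.sources) = a}) : x.1.source = a.1 :=
    congrArg Subtype.val (Finset.mem_filter.1 x.2).2
  rw [← Nat.card_eq_finsetCard]
  refine Nat.card_le_card_of_injective (fun x => x.1.truncate (hsrc x) n han) fun x z e => ?_
  refine Subtype.ext (InfPath.ext_edge ((hsrc x).trans (hsrc z).symm) fun k hx hz => ?_)
  -- Edges below `n` are recorded by the truncation; from `n` on both paths agree with `y`.
  obtain hk | hk := lt_or_ge k n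
  · exact congrFun (congrFun (congrFun (congrArg FinPath.edge e) k) (hsrc x ▸ hx)) hk
  · exact ((hF _ (Finset.mem_filter.1 x.2).1).2.2 k hk).trans
      ((hF _ (Finset.mem_filter.1 z.2).1).2.2 k hk).symm

/-- A finite set of arrows with a common source whose lengths are at most `M` has at most
`max 1 M` elements. -/
theorem card_le_of_length_le {y : B.InfPath} {M : ℝ} (F : Finset B.PathGroupoid)
    (hy : ∀ γ ∈ F, γ.1.2 = y) (hM : ∀ γ ∈ F, length γ ≤ M) : (F.card : ℝ) ≤ max 1 M := by
  classical
  have hinj : Set.InjOn (fun γ : B.PathGroupoid => γ.1.1) F := fun γ hγ μ hμ e =>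
    Subtype.ext (Prod.ext e ((hy γ hγ).trans (hy μ hμ).symm))
  by_cases hF : ∀ γ ∈ F, γ.1.1 = y
  · refine le_max_of_le_left ?_
    exact_mod_cast Finset.card_le_one.2 fun γ hγ μ hμ => hinj hγ hμ ((hF γ hγ).trans (hF μ hμ).symm)
  -- Only non-units compete for the maximum: a unit has length `0` whatever its `agreeLevel`, so its
  -- level is not bounded through its length.
  · obtain ⟨γ, hγ, hmax⟩ := Finset.exists_max_image {γ ∈ F | γ.1.1 ≠ y} agreeLevel (by
      push Not at hF
      obtain ⟨γ, hγ, hne⟩ := hF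
      exact ⟨γ, Finset.mem_filter.2 ⟨hγ, hne⟩⟩)
    obtain ⟨hγF, hγy⟩ := Finset.mem_filter.1 hγ
    have hyγ := hy γ hγF
    have hlen := hM γ hγF
    rw [length, if_neg (by rwa [hyγ])] at hlen
    refine le_max_of_le_right (le_trans ?_ hlen)
    rw [← Finset.card_image_of_injOn hinj]
    refine Nat.cast_le.2 (card_le_finsum_card_finPath (y := y) _ fun x hx => ?_)
    obtain ⟨μ, hμ, rfl⟩ := Finset.mem_image.1 hx
    -- A unit still lies in the `P_n` of the maximal `γ`, because `y` starts at level at most `n`.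
    by_cases hμy : μ.1.1 = y
    · simp only [hμy]
      refine tailRel_mono ?_ (tailRel_refl y)
      rw [← hyγ]
      exact (mem_tailRel_agreeLevel γ).2.1
    · have := tailRel_mono (hmax μ (Finset.mem_filter.2 ⟨hμ, hμy⟩)) (mem_tailRel_agreeLevel μ)
      rwa [← hy μ hμ]

/-- The bound on finite subsets forces finiteness, which must be known separately since `ncard` is
`0` on infinite sets. -/
theorem finite_and_ncard_le_of_length_le {y : B.InfPath} {M : ℝ} (A : Set B.PathGroupoid)
    (hy : ∀ γ ∈ A, γ.1.2 = y) (hM : ∀ γ ∈ A, length γ ≤ M) :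
    A.Finite ∧ (A.ncard : ℝ) ≤ max 1 M := by
  have hfin : A.Finite := by
    by_contra hA
    obtain ⟨F, hF, hcard⟩ := Set.Infinite.exists_subset_card_eq hA (⌊max 1 M⌋₊ + 1)
    have := card_le_of_length_le F (fun γ hγ => hy γ (hF hγ)) (fun γ hγ => hM γ (hF hγ))
    rw [hcard] at this
    push_cast at this
    exact this.not_gt (Nat.lt_floor_add_one _)
  refine ⟨hfin, ?_⟩
  rw [Set.ncard_eq_toFinset_card A hfin]
  exact card_le_of_length_le _ (fun γ hγ => hy γ (hfin.mem_toFinset.1 hγ))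
    (fun γ hγ => hM γ (hfin.mem_toFinset.1 hγ))

theorem length_nonneg (γ : B.PathGroupoid) : 0 ≤ length γ := by
  unfold length
  split_ifs
  · rfl
  · positivity

theorem agreeLevel_inv (γ : B.PathGroupoid) : agreeLevel (ArrowGroupoid.inv γ) = agreeLevel γ :=
  congrArg sInf (Set.ext fun _ => ⟨tailRel_symm, tailRel_symm⟩)

theorem length_inv (γ : B.PathGroupoid) : length (ArrowGroupoid.inv γ) = length γ := by
  by_cases h : γ.1.1 = γ.1.2
  · exact (if_pos h.symm).trans (if_pos h).symm
  · refine (if_neg (Ne.symm h)).trans (Eq.trans ?_ (if_neg h).symm)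
    rw [agreeLevel_inv]

/-- Allowing any injection `e` covers both the isomorphism and its composite with inversion, hence
source and range fibers alike. -/
theorem finite_and_ncard_le_of_injective {G : Type*} {y : B.InfPath} {M : ℝ}
    {e : G → B.PathGroupoid} (he : Function.Injective e) (A : Set G)
    (hy : ∀ γ ∈ A, (e γ).1.2 = y) (hM : ∀ γ ∈ A, length (e γ) ≤ M) :
    A.Finite ∧ (A.ncard : ℝ) ≤ max 1 M := by
  obtain ⟨hf, hc⟩ := finite_and_ncard_le_of_length_le (y := y) (M := M) (e '' A)
    (Set.forall_mem_image.2 hy) (Set.forall_mem_image.2 hM)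
  rw [Set.ncard_image_of_injective A he] at hc
  exact ⟨hf.of_finite_image he.injOn, hc⟩

end BratteliDiagram

theorem lemma4p6 {G : Type u} [TopologicalSpace G] [ArrowGroupoid G]
    (hG : IsCompact (ArrowGroupoid.units G))
    (B : BratteliDiagram.{v, w}) (φ : ArrowGroupoid.TopIso G B.PathGroupoid) :
    (∀ y ∈ ArrowGroupoid.units G, ∀ M : ℝ, 0 ≤ M →
      (ArrowGroupoid.srcFiber y ∩ {γ : G | BratteliDiagram.length (φ.toHomeomorph γ) ≤ M}).Finite ∧
      ((ArrowGroupoid.srcFiber y ∩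
        {γ : G | BratteliDiagram.length (φ.toHomeomorph γ) ≤ M}).ncard : ℝ) ≤ max 1 M) ∧
    ArrowGroupoid.HasLinearGrowth (fun γ : G => BratteliDiagram.length (φ.toHomeomorph γ)) ∧
    ArrowGroupoid.HasRapidDecay (fun γ : G => BratteliDiagram.length (φ.toHomeomorph γ)) := by
  have hsrc (y : G) (M : ℝ) := BratteliDiagram.finite_and_ncard_le_of_injective
    (y := (φ.toHomeomorph y).1.2) (M := M) φ.toHomeomorph.injective
    (ArrowGroupoid.srcFiber y ∩ {γ : G | BratteliDiagram.length (φ.toHomeomorph γ) ≤ M})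
    (fun γ hγ => by
      have h := φ.map_src γ
      rw [show ArrowGroupoid.src γ = y from hγ.1] at h
      exact (congrArg (fun p : B.PathGroupoid => p.1.2) h).symm)
    (fun γ hγ => hγ.2)
  -- Inversion preserves length and turns range fibers into source fibers.
  have hrng (y : G) (M : ℝ) := BratteliDiagram.finite_and_ncard_le_of_injective
    (y := (φ.toHomeomorph y).1.1) (M := M)
    (ArrowGroupoid.inv_injective.comp φ.toHomeomorph.injective)
    (ArrowGroupoid.rngFiber y ∩ {γ : G | BratteliDiagram.length (φ.toHomeomorph γ) ≤ M})
    (fun γ hγ => by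
      have h := φ.map_rng γ
      rw [show ArrowGroupoid.rng γ = y from hγ.1] at h
      exact (congrArg (fun p : B.PathGroupoid => p.1.1) h).symm)
    (fun γ hγ => (BratteliDiagram.length_inv _).trans_le hγ.2)
  have hmax {t : ℝ} (ht : 0 ≤ t) : max 1 t ≤ 1 + t := max_le (by linarith) (by linarith)
  refine ⟨fun y _ M _ => hsrc y M, ⟨1 + Polynomial.X, ?_, fun t ht x _ => ?_⟩, ?_⟩
  · compute_degree
  · refine ⟨(hsrc x t).1, (hsrc x t).2.trans ?_⟩
    simpa using hmax ht
  · exact ArrowGroupoid.hasRapidDecay_of_linear_growth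
      (fun γ => BratteliDiagram.length_nonneg _)
      (fun t ht x _ => ⟨(hsrc x t).1, (hsrc x t).2.trans (hmax ht)⟩)
      (fun t ht x _ => ⟨(hrng x t).1, (hrng x t).2.trans (hmax ht)⟩)
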